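/- Let $G$ be a group, $H\leqslant G$ a subgroup and $g\in G$. The order $\mathrm{Ord}_H(g)$ of $g$ in $H$ is the least integer $k\geqslant 1$ such that $g^k\in H$, or $0$ if there is no such $k$; the spectrum of $G$ with respect to $H$ is $\mathrm{Ord}_H(G)=\{\mathrm{Ord}_H(g) : g\in G\}$. (1) Let $\mathcal O\neq\{0\}$ be a set of non-negative integers that contains $0$ and contains every positive divisor of each of its nonzero elements. Then there exist a finitely generated torsion-free group $G$ and a finitely generated subgroup $H\leqslant G$ such that $\mathrm{Ord}_H(G)=\mathcal O$. (2) Consequently, there exist a finitely generated torsion-free group $G$ and a finitely generated subgroup $H\leqslant G$ such that $\mathrm{Ord}_H(G)$ is not computably enumerable; and there also exist such $G$ and $H$ for which $\mathrm{Ord}_H(G)$ is computably enumerable but not computable. -/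

import Mathlib

/-- The relative order of `g` in a subset `S` of a group: the least `k ≥ 1` with `g ^ k ∈ S`,
and `0` if there is no such `k` (the infimum of the empty set of naturals is `0`). -/
noncomputable def relOrder {G : Type*} [Group G] (S : Set G) (g : G) : ℕ :=
  sInf {k : ℕ | 1 ≤ k ∧ g ^ k ∈ S}

/-- The spectrum of `G` with respect to `S`: the set of all relative orders in `S` of elements
of `G`. -/
def relSpectrum {G : Type*} [Group G] (S : Set G) : Set ℕ :=
  {k : ℕ | ∃ g : G, relOrder S g = k}

/-- A group is torsion-free if only the identity has finite order. (Mathlib's `IsMulTorsionFree`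
asks for unique roots, which is stronger for nonabelian groups.) -/
def TorsionFreeGroup (G : Type*) [Group G] : Prop :=
  ∀ g : G, IsOfFinOrder g → g = 1

/-- Every divisor of a nonzero element of `O` lies in `O`. The element `0` imposes no condition:
it stands for infinite order, and counting all integers as its divisors would leave only `O = ℕ`. -/
def DivisorClosed (O : Set ℕ) : Prop :=
  ∀ n ∈ O, n ≠ 0 → ∀ d : ℕ, d ∣ n → d ∈ O

/-!
The orders of elements in a free product of cyclic groups `ℤ/n`, `n ∈ O \ {0}`, are exactly the
elements of the divisor-closed set `O` (with `0` for infinite order), because torsion in a free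
product is conjugate into a factor. Embedding each `ℤ/n` in `ℚ/ℤ` gives a character of the free
product which is injective on the factors, so its kernel is torsion-free. The pullback of this
character along `ℚ → ℚ/ℤ` is therefore torsion-free, and it is a central extension of the free
product by `ℤ`; orders relative to that central `ℤ` are the orders in the free product.

The pullback is countable, and a countable torsion-free group embeds in a finitely generated one
inside `(A ≀ ℤ) ≀ ℤ`, in the manner of B. H. Neumann and H. Neumann. The image is closed under roots
there, so the elements outside it only contribute the relative order `0`.

For the computability statements, the divisors of the Fermat numbers indexed by a set of programs
form a divisor-closed set to which that set is many-one reducible, Fermat numbers being pairwise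
coprime; the set is then taken to be the halting set or its complement.
-/

open Monoid (CoprodI)
open Monoid.CoprodI (NeWord Word)
open RegularWreathProduct (inl left right rightHom)
open scoped commutatorElement

section RelativeOrder

variable {G K : Type*} [Group G] [Group K]

theorem relSpectrum_eq_range (S : Set G) : relSpectrum S = Set.range (relOrder S) := rfl

theorem relOrder_preimage (f : G →* K) (S : Set K) (g : G) :
    relOrder (f ⁻¹' S) g = relOrder S (f g) := by
  simp only [relOrder, Set.mem_preimage, map_pow]

theorem relOrder_eq_zero {S : Set G} {g : G} (h : ∀ k, k ≠ 0 → g ^ k ∉ S) : relOrder S g = 0 :=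
  Nat.sInf_eq_zero.2 <| Or.inr <| Set.eq_empty_of_forall_notMem fun k hk =>
    h k (Nat.one_le_iff_ne_zero.1 hk.1) hk.2

theorem relOrder_singleton_one (g : G) : relOrder {1} g = orderOf g := by
  by_cases hg : IsOfFinOrder g
  · refine IsLeast.csInf_eq ⟨⟨hg.orderOf_pos, pow_orderOf_eq_one g⟩, ?_⟩
    rintro k ⟨hk, h⟩
    exact orderOf_le_of_pow_eq_one hk h
  · rw [orderOf_eq_zero hg]
    exact relOrder_eq_zero fun k hk h =>
      hg (isOfFinOrder_iff_pow_eq_one.2 ⟨k, Nat.pos_of_ne_zero hk, h⟩)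

theorem relSpectrum_ker {f : G →* K} (hf : Function.Surjective f) :
    relSpectrum (f.ker : Set G) = Set.range (orderOf : K → ℕ) := by
  have h : relOrder (f.ker : Set G) = orderOf ∘ f := funext fun g =>
    (relOrder_preimage f {1} g).trans (relOrder_singleton_one (f g))
  rw [relSpectrum_eq_range, h, hf.range_comp]

end RelativeOrder

section Isolated

/-- A subgroup is isolated if it is closed under taking roots. -/
def IsIsolated {G : Type*} [Group G] (H : Subgroup G) : Prop :=
  ∀ (g : G) (k : ℕ), k ≠ 0 → g ^ k ∈ H → g ∈ H

variable {G K : Type*} [Group G] [Group K]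

theorem isIsolated_bot_iff : IsIsolated (⊥ : Subgroup G) ↔ TorsionFreeGroup G := by
  refine forall_congr' fun g => ?_
  simp only [Subgroup.mem_bot, isOfFinOrder_iff_pow_eq_one, Nat.pos_iff_ne_zero]
  exact ⟨fun h ⟨k, hk, hg⟩ => h k hk hg, fun h k hk hg => h ⟨k, hk, hg⟩⟩

theorem IsIsolated.comap {H : Subgroup K} (hH : IsIsolated H) (f : G →* K) :
    IsIsolated (H.comap f) := fun g k hk hg =>
  hH (f g) k hk (by rwa [Subgroup.mem_comap, map_pow] at hg)

theorem IsIsolated.map {H : Subgroup G} (hH : IsIsolated H) {f : G →* K}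
    (hf : Function.Injective f) (hr : IsIsolated f.range) : IsIsolated (H.map f) := by
  rintro x k hk ⟨h, hh, hx⟩
  obtain ⟨g, rfl⟩ := hr x k hk ⟨h, hx⟩
  rw [← map_pow] at hx
  exact ⟨g, hH g k hk (hf hx ▸ hh), rfl⟩

theorem IsIsolated.pi {ι : Type*} {G : ι → Type*} [∀ i, Group (G i)] {H : ∀ i, Subgroup (G i)}
    (hH : ∀ i, IsIsolated (H i)) (s : Set ι) : IsIsolated (Subgroup.pi s H) :=
  fun g k hk hg i hi => hH i (g i) k hk (hg i hi)

theorem relSpectrum_map {f : G →* K} (hf : Function.Injective f) (hr : IsIsolated f.range)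
    (hne : f.range ≠ ⊤) (H : Subgroup G) :
    relSpectrum (H.map f : Set K) = insert 0 (relSpectrum (H : Set G)) := by
  have hmap : ∀ g, relOrder (H.map f : Set K) (f g) = relOrder (H : Set G) g := fun g => by
    rw [← relOrder_preimage, Subgroup.coe_map, Set.preimage_image_eq _ hf]
  have hzero : ∀ x ∉ f.range, relOrder (H.map f : Set K) x = 0 := fun x hx =>
    relOrder_eq_zero fun k hk hxk => hx (hr x k hk (H.map_le_range f hxk))
  ext n
  constructor
  · rintro ⟨x, rfl⟩
    by_cases hx : x ∈ f.range
    · obtain ⟨g, rfl⟩ := hx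
      exact Or.inr ⟨g, (hmap g).symm⟩
    · exact Or.inl (hzero x hx)
  · rintro (rfl | ⟨g, rfl⟩)
    · obtain ⟨x, -, hx⟩ := SetLike.exists_of_lt (lt_top_iff_ne_top.2 hne)
      exact ⟨x, hzero x hx⟩
    · exact ⟨f g, hmap g⟩

end Isolated

section TorsionFree

variable {G K : Type*} [Group G] [Group K]

theorem torsionFreeGroup_of_isMulTorsionFree [IsMulTorsionFree G] : TorsionFreeGroup G :=
  fun _ hg => by_contra fun h => not_isOfFinOrder_of_isMulTorsionFree h hg

theorem TorsionFreeGroup.of_injective (hK : TorsionFreeGroup K) {f : G →* K}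
    (hf : Function.Injective f) : TorsionFreeGroup G := fun g hg =>
  (map_eq_one_iff f hf).1 (hK (f g) (f.isOfFinOrder hg))

theorem torsionFreeGroup_ker_iff {f : G →* K} :
    TorsionFreeGroup f.ker ↔ ∀ g, IsOfFinOrder g → f g = 1 → g = 1 := by
  refine ⟨fun h g hg hfg => ?_, fun h g hg => ?_⟩
  · exact congrArg Subtype.val (h ⟨g, hfg⟩ (Submonoid.isOfFinOrder_coe.1 hg))
  · exact Subtype.ext (h g (Submonoid.isOfFinOrder_coe.2 hg) g.2)

end TorsionFree

section FiberProduct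

variable {G M K : Type*} [Group G] [Group M] [Group K]

/-- The pullback `G ×_K M` of two homomorphisms with target `K`. -/
def fiberProduct (f : G →* K) (p : M →* K) : Subgroup (G × M) :=
  (f.comp (.fst G M)).eqLocus (p.comp (.snd G M))

/-- The projection of the pullback onto its first factor. -/
def fiberProductFst (f : G →* K) (p : M →* K) : fiberProduct f p →* G :=
  (MonoidHom.fst G M).comp (fiberProduct f p).subtype

theorem fiberProductFst_surjective (f : G →* K) {p : M →* K} (hp : Function.Surjective p) :
    Function.Surjective (fiberProductFst f p) := fun g =>
  let ⟨m, hm⟩ := hp (f g)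
  ⟨⟨(g, m), hm.symm⟩, rfl⟩

theorem torsionFreeGroup_fiberProduct {f : G →* K} {p : M →* K} (hf : TorsionFreeGroup f.ker)
    (hM : TorsionFreeGroup M) : TorsionFreeGroup (fiberProduct f p) := by
  rintro ⟨⟨g, m⟩, hgm⟩ hfin
  have hg : IsOfFinOrder g := (fiberProductFst f p).isOfFinOrder hfin
  obtain rfl : m = 1 :=
    hM m (((MonoidHom.snd G M).comp (fiberProduct f p).subtype).isOfFinOrder hfin)
  obtain rfl : g = 1 := torsionFreeGroup_ker_iff.1 hf g hg (hgm.trans (map_one p))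
  rfl

theorem fg_ker_fiberProductFst (f : G →* K) {p : M →* K} (hp : p.ker.FG) :
    (fiberProductFst f p).ker.FG := by
  have : Group.FG p.ker := (Group.fg_iff_subgroup_fg _).2 hp
  let i : p.ker →* fiberProduct f p :=
    ((MonoidHom.inr G M).comp p.ker.subtype).codRestrict (fiberProduct f p) fun m =>
      (map_one f).trans m.2.symm
  have hi : (fiberProductFst f p).ker = i.range := by
    ext ⟨⟨g, m⟩, hgm⟩
    constructor
    · rintro (rfl : g = 1)
      exact ⟨⟨m, (map_one f).symm.trans hgm |>.symm⟩, rfl⟩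
    · rintro ⟨m, hm⟩
      exact congrArg (fun x => x.1.1) hm.symm
  rw [hi, ← Group.fg_iff_subgroup_fg]
  infer_instance

end FiberProduct

section FreeProduct

variable {ι : Type*} {M : ι → Type*} [∀ i, Monoid (M i)]

theorem neWord_prod_ne_one {i j : ι} (w : NeWord M i j) : w.prod ≠ 1 := by
  classical
  intro h
  have hw : w.toWord = Word.empty := Word.equiv.symm.injective h
  exact w.toList_ne_nil (congrArg Word.toList hw)

theorem exists_neWord_prod_eq_pow {i j : ι} (w : NeWord M i j) (hij : i ≠ j) (k : ℕ) :
    ∃ w' : NeWord M i j, w'.prod = w.prod ^ (k + 1) := by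
  induction k with
  | zero => exact ⟨w, by rw [zero_add, pow_one]⟩
  | succ k ih =>
    obtain ⟨w', hw'⟩ := ih
    exact ⟨w'.append hij.symm w, by rw [NeWord.append_prod, hw', pow_succ _ (k + 1)]⟩

theorem not_isOfFinOrder_neWord_prod {i j : ι} (w : NeWord M i j) (hij : i ≠ j) :
    ¬ IsOfFinOrder w.prod := by
  rw [isOfFinOrder_iff_pow_eq_one]
  rintro ⟨n, hn, h⟩
  obtain ⟨w', hw'⟩ := exists_neWord_prod_eq_pow w hij (n - 1)
  rw [Nat.sub_add_cancel hn, h] at hw'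
  exact neWord_prod_ne_one w' hw'

end FreeProduct

section CyclicReduction

variable {ι : Type*} {G : ι → Type*} [∀ i, Group (G i)]

/-- The element of the free product spelled by a word which need not be reduced. -/
def spell (L : List (Σ i, G i)) : CoprodI G :=
  (L.map fun l => CoprodI.of l.2).prod

theorem spell_cons (l : Σ i, G i) (L : List (Σ i, G i)) :
    spell (l :: L) = CoprodI.of l.2 * spell L := List.prod_cons

theorem spell_append (L L' : List (Σ i, G i)) : spell (L ++ L') = spell L * spell L' := by
  simp only [spell, List.map_append, List.prod_append]

theorem spell_singleton (l : Σ i, G i) : spell [l] = CoprodI.of l.2 := List.prod_singleton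

theorem spell_surjective : Function.Surjective (spell : List (Σ i, G i) → CoprodI G) := by
  classical
  exact fun x => ⟨(Word.equiv x).toList, Word.equiv.symm_apply_apply x⟩

/-- A word is conjugacy-minimal if it is as short as any word spelling a conjugate. Such words are
cyclically reduced. -/
def ConjMinimal (L : List (Σ i, G i)) : Prop :=
  ∀ L' : List (Σ i, G i), IsConj (spell L) (spell L') → L.length ≤ L'.length

theorem exists_conjMinimal_isConj_spell (x : CoprodI G) :
    ∃ L, ConjMinimal L ∧ IsConj (spell L) x := by
  obtain ⟨L₀, rfl⟩ := spell_surjective x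
  obtain ⟨L, hL, hmin⟩ := exists_minimalFor_of_wellFoundedLT
    (fun L => IsConj (spell L) (spell L₀)) List.length ⟨L₀, IsConj.refl _⟩
  exact ⟨L, fun L' h => (le_total _ _).elim id (hmin (h.symm.trans hL)), hL⟩

namespace ConjMinimal

variable {L : List (Σ i, G i)}

theorem le_length_of_spell_eq (hL : ConjMinimal L) {L' : List (Σ i, G i)}
    (h : spell L' = spell L) : L.length ≤ L'.length :=
  hL L' (h ▸ IsConj.refl _)

theorem ne_one (hL : ConjMinimal L) {l : Σ i, G i} (hl : l ∈ L) : l.2 ≠ 1 := by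
  obtain ⟨s, t, rfl⟩ := List.append_of_mem hl
  intro h1
  have := hL.le_length_of_spell_eq (L' := s ++ t) (by
    rw [spell_append, spell_append, spell_cons, h1, map_one, one_mul])
  simp at this

theorem isChain (hL : ConjMinimal L) : L.IsChain fun l l' => l.1 ≠ l'.1 := by
  rw [List.isChain_iff_forall_rel_of_append_cons_cons]
  rintro ⟨i, a⟩ ⟨j, b⟩ s t rfl (rfl : i = j)
  have := hL.le_length_of_spell_eq (L' := s ++ ⟨i, a * b⟩ :: t) (by
    simp only [spell_append, spell_cons, map_mul, mul_assoc])
  simp at this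

theorem fst_ne_fst {l l' : Σ i, G i} (hL : ConjMinimal (l :: (L ++ [l']))) : l.1 ≠ l'.1 := by
  obtain ⟨i, a⟩ := l
  obtain ⟨j, b⟩ := l'
  rintro (rfl : i = j)
  have := hL (L ++ [⟨i, b * a⟩]) (isConj_iff.2 ⟨(CoprodI.of a)⁻¹, by
    rw [spell_cons, spell_append, spell_append, spell_singleton, spell_singleton, map_mul]
    group⟩)
  simp at this

theorem not_isOfFinOrder_spell {l l' : Σ i, G i} (hL : ConjMinimal (l :: (L ++ [l']))) :
    ¬ IsOfFinOrder (spell (l :: (L ++ [l']))) := by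
  obtain ⟨i, j, w, hw⟩ := NeWord.of_word ⟨_, fun _ => hL.ne_one, hL.isChain⟩
    fun h => List.cons_ne_nil _ _ (congrArg Word.toList h)
  have hlist : w.toList = l :: (L ++ [l']) := congrArg Word.toList hw
  have hi : l = ⟨i, w.head⟩ := by simpa [hlist] using w.toList_head?
  have hj : l' = ⟨j, w.last⟩ := by simpa [hlist, List.getLast?_cons] using w.toList_getLast?
  have hprod : spell (l :: (L ++ [l'])) = w.prod := congrArg spell hlist.symm
  rw [hprod]
  exact not_isOfFinOrder_neWord_prod w (by simpa [hi, hj] using hL.fst_ne_fst)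

end ConjMinimal

theorem eq_one_or_exists_isConj_of_isOfFinOrder {x : CoprodI G} (hx : IsOfFinOrder x) :
    x = 1 ∨ ∃ (i : ι) (g : G i), IsConj (CoprodI.of g) x := by
  obtain ⟨L, hL, hLx⟩ := exists_conjMinimal_isConj_spell x
  rcases L with _ | ⟨l, L⟩
  · exact Or.inl (isConj_one_right.1 hLx)
  · rcases L.eq_nil_or_concat with rfl | ⟨L, l', rfl⟩
    · exact Or.inr ⟨l.1, l.2, spell_singleton l ▸ hLx⟩
    · rw [List.concat_eq_append] at hL hLx
      exact absurd (hLx.symm.isOfFinOrder hx) hL.not_isOfFinOrder_spell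

theorem torsionFreeGroup_ker_lift {K : Type*} [Group K] {f : ∀ i, G i →* K}
    (hf : ∀ i, TorsionFreeGroup (f i).ker) : TorsionFreeGroup (CoprodI.lift f).ker := by
  refine torsionFreeGroup_ker_iff.2 fun x hx hfx => ?_
  obtain rfl | ⟨i, g, hg⟩ := eq_one_or_exists_isConj_of_isOfFinOrder hx
  · rfl
  have hfg : f i g = 1 := by
    have := (CoprodI.lift f).map_isConj hg
    rwa [hfx, CoprodI.lift_of, isConj_one_left] at this
  have hg1 : g = 1 := torsionFreeGroup_ker_iff.1 (hf i) g
    ((CoprodI.of_injective i).isOfFinOrder_iff.1 (hg.symm.isOfFinOrder hx)) hfg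
  rwa [hg1, map_one, isConj_one_right] at hg

theorem insert_zero_range_orderOf_coprodI [Nonempty ι] :
    insert 0 (Set.range (orderOf : CoprodI G → ℕ)) =
      insert 0 (⋃ i, Set.range (orderOf : G i → ℕ)) := by
  refine Set.Subset.antisymm (Set.insert_subset (Set.mem_insert _ _) ?_)
    (Set.insert_subset_insert (Set.iUnion_subset fun i => ?_))
  · rintro _ ⟨x, rfl⟩
    by_cases hx : IsOfFinOrder x
    · obtain rfl | ⟨i, g, hg⟩ := eq_one_or_exists_isConj_of_isOfFinOrder hx
      · obtain ⟨i⟩ := ‹Nonempty ι›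
        exact Or.inr (Set.mem_iUnion.2 ⟨i, 1, by rw [orderOf_one, orderOf_one]⟩)
      · obtain ⟨c, rfl⟩ := isConj_iff.1 hg
        refine Or.inr (Set.mem_iUnion.2 ⟨i, g, ?_⟩)
        rw [← MulAut.conj_apply, MulEquiv.orderOf_eq,
          orderOf_injective _ (CoprodI.of_injective i)]
    · exact Or.inl (orderOf_eq_zero hx)
  · rintro _ ⟨g, rfl⟩
    exact ⟨CoprodI.of g, orderOf_injective _ (CoprodI.of_injective i) g⟩

end CyclicReduction

section CyclicFactors

theorem coprodI_countable {ι : Type*} [Countable ι] {G : ι → Type*} [∀ i, Group (G i)]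
    [∀ i, Countable (G i)] : Countable (CoprodI G) :=
  spell_surjective.countable

theorem torsionFreeGroup_ker_of_injective {G K : Type*} [Group G] [Group K] {f : G →* K}
    (hf : Function.Injective f) : TorsionFreeGroup f.ker :=
  torsionFreeGroup_ker_iff.2 fun _ _ hg => (map_eq_one_iff f hf).1 hg

theorem range_orderOf_zpowers {G : Type*} [Group G] {g : G} (hg : IsOfFinOrder g) :
    Set.range (orderOf : Subgroup.zpowers g → ℕ) = {d | d ∣ orderOf g} := by
  ext d
  constructor
  · rintro ⟨x, rfl⟩
    rw [← Subgroup.orderOf_coe]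
    exact orderOf_dvd_of_mem_zpowers x.2
  · rintro ⟨m, hm⟩
    have hm0 : m ≠ 0 := right_ne_zero_of_mul (hm ▸ hg.orderOf_pos.ne')
    refine ⟨⟨g ^ m, Subgroup.npow_mem_zpowers g m⟩, ?_⟩
    rw [Subgroup.orderOf_mk, orderOf_pow_of_dvd hm0 (hm ▸ dvd_mul_left m d), hm,
      Nat.mul_div_cancel _ (Nat.pos_of_ne_zero hm0)]

/-- The homomorphism `ℚ → ℚ/ℤ`, written multiplicatively. -/
noncomputable def ratModInt : Multiplicative ℚ →* Multiplicative (AddCircle (1 : ℚ)) :=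
  AddMonoidHom.toMultiplicative (QuotientAddGroup.mk' (AddSubgroup.zmultiples (1 : ℚ)))

theorem ratModInt_surjective : Function.Surjective ratModInt :=
  QuotientAddGroup.mk'_surjective (AddSubgroup.zmultiples (1 : ℚ))

theorem fg_ker_ratModInt : ratModInt.ker.FG := by
  refine ⟨{Multiplicative.ofAdd 1}, ?_⟩
  ext r
  rw [Finset.coe_singleton, Subgroup.mem_closure_singleton]
  exact (AddCircle.coe_eq_zero_iff (1 : ℚ) (x := r.toAdd)).symm

theorem orderOf_ratModInt {n : ℕ} (hn : 0 < n) :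
    orderOf (ratModInt (Multiplicative.ofAdd (1 / n))) = n :=
  AddCircle.addOrderOf_period_div hn

theorem exists_torsionFree_relSpectrum_eq_range_orderOf.{u} {G : Type u} [Group G] [Countable G]
    (χ : G →* Multiplicative (AddCircle (1 : ℚ))) (hχ : TorsionFreeGroup χ.ker) :
    ∃ (A : Type u) (_ : Group A) (H : Subgroup A),
      Countable A ∧ TorsionFreeGroup A ∧ H.FG ∧
        relSpectrum (H : Set A) = Set.range (orderOf : G → ℕ) := by
  have : Countable (Multiplicative ℚ) := inferInstanceAs (Countable ℚ)
  exact ⟨fiberProduct χ ratModInt, inferInstance, (fiberProductFst χ ratModInt).ker, inferInstance,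
    torsionFreeGroup_fiberProduct hχ torsionFreeGroup_of_isMulTorsionFree,
    fg_ker_fiberProductFst χ fg_ker_ratModInt,
    relSpectrum_ker (fiberProductFst_surjective χ ratModInt_surjective)⟩

theorem exists_torsionFree_insert_zero_relSpectrum_eq.{u} {ι : Type u} [Countable ι]
    [Nonempty ι] {n : ι → ℕ} (hn : ∀ i, 0 < n i) :
    ∃ (A : Type u) (_ : Group A) (H : Subgroup A),
      Countable A ∧ TorsionFreeGroup A ∧ H.FG ∧
        insert 0 (relSpectrum (H : Set A)) = insert 0 {d | ∃ i, d ∣ n i} := by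
  let c (i : ι) : Multiplicative (AddCircle (1 : ℚ)) := ratModInt (Multiplicative.ofAdd (1 / n i))
  have hc (i : ι) : orderOf (c i) = n i := orderOf_ratModInt (hn i)
  have hfin (i : ι) : IsOfFinOrder (c i) := orderOf_pos_iff.1 (hc i ▸ hn i)
  have hcount (i : ι) : Countable (Subgroup.zpowers (c i)) :=
    (Set.countable_range fun k : ℤ => c i ^ k).to_subtype
  have := coprodI_countable (G := fun i => Subgroup.zpowers (c i))
  obtain ⟨A, hA, H, hcountA, htf, hfg, hs⟩ := exists_torsionFree_relSpectrum_eq_range_orderOf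
    (CoprodI.lift fun i => (Subgroup.zpowers (c i)).subtype)
    (torsionFreeGroup_ker_lift fun _ => torsionFreeGroup_ker_of_injective Subtype.val_injective)
  refine ⟨A, hA, H, hcountA, htf, hfg, ?_⟩
  simp only [hs, insert_zero_range_orderOf_coprodI, range_orderOf_zpowers (hfin _), hc]
  congr 1
  ext d
  exact Set.mem_iUnion

end CyclicFactors

theorem range_mulSingle {D Q : Type*} [Group D] [DecidableEq Q] (q : Q) :
    (MonoidHom.mulSingle (fun _ => D) q).range = Subgroup.pi {q}ᶜ fun _ => ⊥ := by
  ext f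
  constructor
  · rintro ⟨d, rfl⟩ x hx
    exact Pi.mulSingle_eq_of_ne (M := fun _ => D) hx d
  · intro hf
    refine ⟨f q, funext fun x => ?_⟩
    rcases eq_or_ne x q with rfl | hx
    · exact Pi.mulSingle_eq_same (M := fun _ => D) x (f x)
    · exact (Pi.mulSingle_eq_of_ne (M := fun _ => D) hx (f q)).trans (hf x hx).symm

section WreathProduct

variable {D Q : Type*} [Group D] [Group Q]

/-- The inclusion of the base group `Q → D` into the wreath product. -/
def wreathBase : (Q → D) →* D ≀ᵣ Q where
  toFun f := ⟨f, 1⟩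
  map_one' := rfl
  map_mul' f g := by ext <;> simp

theorem wreathBase_injective : Function.Injective (wreathBase : (Q → D) →* D ≀ᵣ Q) :=
  fun _ _ h => congrArg left h

theorem range_wreathBase : (wreathBase : (Q → D) →* D ≀ᵣ Q).range = rightHom.ker := by
  ext g
  constructor
  · rintro ⟨f, rfl⟩
    rfl
  · exact fun hg => ⟨g.left, RegularWreathProduct.ext rfl (Eq.symm hg)⟩

theorem inl_mul_wreathBase_mul_inv (q : Q) (f : Q → D) :
    inl q * wreathBase f * (inl q)⁻¹ = wreathBase fun x => f (q⁻¹ * x) := by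
  ext <;> simp [wreathBase]

theorem isIsolated_range_wreathBase (hQ : TorsionFreeGroup Q) :
    IsIsolated (wreathBase : (Q → D) →* D ≀ᵣ Q).range :=
  range_wreathBase (D := D) (Q := Q) ▸ (isIsolated_bot_iff.2 hQ).comap rightHom

theorem torsionFreeGroup_wreath (hD : TorsionFreeGroup D) (hQ : TorsionFreeGroup Q) :
    TorsionFreeGroup (D ≀ᵣ Q) := by
  have hpi : IsIsolated (⊥ : Subgroup (Q → D)) :=
    Subgroup.pi_bot (f := fun _ : Q => D) ▸ IsIsolated.pi (fun _ => isIsolated_bot_iff.2 hD) _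
  rw [← isIsolated_bot_iff, ← Subgroup.map_bot wreathBase]
  exact hpi.map wreathBase_injective (isIsolated_range_wreathBase hQ)

variable [DecidableEq Q]

/-- The inclusion of `D` into the wreath product as the factor of the base group at `1`. -/
def wreathCoord : D →* D ≀ᵣ Q :=
  wreathBase.comp (MonoidHom.mulSingle (fun _ => D) 1)

theorem wreathCoord_injective : Function.Injective (wreathCoord : D →* D ≀ᵣ Q) :=
  wreathBase_injective.comp (Pi.mulSingle_injective (M := fun _ : Q => D) 1)

theorem isIsolated_range_wreathCoord (hD : TorsionFreeGroup D) (hQ : TorsionFreeGroup Q) :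
    IsIsolated (wreathCoord : D →* D ≀ᵣ Q).range := by
  rw [wreathCoord, MonoidHom.range_comp, range_mulSingle]
  exact (IsIsolated.pi (fun _ => isIsolated_bot_iff.2 hD) _).map wreathBase_injective
    (isIsolated_range_wreathBase hQ)

theorem commutator_conj_wreathBase {f : Q → D} {q : Q} (h : ∀ x ≠ 1, f (q * x) = 1 ∨ f x = 1) :
    ⁅(inl q)⁻¹ * wreathBase f * inl q, wreathBase f⁆ = (wreathCoord ⁅f q, f 1⁆ : D ≀ᵣ Q) := by
  have hconj : (inl q)⁻¹ * wreathBase f * inl q = (wreathBase fun x => f (q * x) : D ≀ᵣ Q) := by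
    simpa only [map_inv, inv_inv] using inl_mul_wreathBase_mul_inv q⁻¹ f
  rw [hconj, ← map_commutatorElement]
  refine congrArg wreathBase (funext fun x => ?_)
  change ⁅f (q * x), f x⁆ = Pi.mulSingle (M := fun _ => D) 1 ⁅f q, f 1⁆ x
  rcases eq_or_ne x 1 with rfl | hx
  · rw [mul_one, Pi.mulSingle_eq_same]
  · rw [Pi.mulSingle_eq_of_ne hx]
    rcases h x hx with h | h
    · rw [h, commutatorElement_one_left]
    · rw [h, commutatorElement_one_right]

end WreathProduct

section OddExtension

variable {B : Type*} [Group B]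

theorem ofAdd_odd_injective :
    Function.Injective fun n : ℕ => Multiplicative.ofAdd (2 * n + 1 : ℤ) := fun m n h => by
  have := Multiplicative.ofAdd.injective h
  omega

/-- The function on `ℤ` with value `v` at `0` and the terms of the sequence `u` at the odd positive
integers. For `q` odd and positive, the support meets its translate by `-q` only in `0`. -/
noncomputable def oddExtension (v : B) (u : ℕ → B) : Multiplicative ℤ → B :=
  Function.extend (fun n : ℕ => Multiplicative.ofAdd (2 * n + 1 : ℤ)) u (Pi.mulSingle 1 v)

theorem oddExtension_odd (v : B) (u : ℕ → B) (n : ℕ) :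
    oddExtension v u (Multiplicative.ofAdd (2 * n + 1 : ℤ)) = u n :=
  ofAdd_odd_injective.extend_apply _ _ n

theorem oddExtension_even (v : B) (u : ℕ → B) {k : ℤ} (hk : Even k) :
    oddExtension v u (Multiplicative.ofAdd k) =
      Pi.mulSingle (M := fun _ => B) 1 v (Multiplicative.ofAdd k) := by
  refine Function.extend_apply' _ _ _ ?_
  rintro ⟨n, hn⟩
  have := Multiplicative.ofAdd.injective hn
  exact Int.not_even_two_mul_add_one n (this ▸ hk)

theorem oddExtension_one (v : B) (u : ℕ → B) : oddExtension v u 1 = v :=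
  (oddExtension_even v u (k := 0) .zero).trans (Pi.mulSingle_eq_same (M := fun _ => B) 1 v)

theorem oddExtension_mul_eq_one_or (v : B) (u : ℕ → B) (n : ℕ) (x : Multiplicative ℤ)
    (hx : x ≠ 1) :
    oddExtension v u (Multiplicative.ofAdd (2 * n + 1 : ℤ) * x) = 1 ∨ oddExtension v u x = 1 := by
  by_cases h : ∃ m : ℕ, Multiplicative.ofAdd (2 * m + 1 : ℤ) = x
  · obtain ⟨m, rfl⟩ := h
    left
    have hne : (2 * n + 1 + (2 * m + 1) : ℤ) ≠ 0 := by omega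
    rw [← ofAdd_add, oddExtension_even v u (Odd.add_odd ⟨n, rfl⟩ ⟨m, rfl⟩)]
    exact Pi.mulSingle_eq_of_ne (M := fun _ => B) (ofAdd_eq_one.not.2 hne) v
  · right
    exact (Function.extend_apply' _ _ _ h).trans
      (Pi.mulSingle_eq_of_ne (M := fun _ => B) hx v)

end OddExtension

section Embedding

variable {A : Type*} [Group A]

/-- The translation generating the acting group of `A ≀ ℤ`. -/
def wreathShift : A ≀ᵣ Multiplicative ℤ := inl (Multiplicative.ofAdd 1)

theorem wreathShift_zpow (k : ℤ) :
    (wreathShift : A ≀ᵣ Multiplicative ℤ) ^ k = inl (Multiplicative.ofAdd k) := by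
  rw [wreathShift, ← map_zpow, ← ofAdd_zsmul, smul_eq_mul, mul_one]

/-- The element of the base group of `A ≀ ℤ` with value `a` on the nonnegative integers and `1` on
the negative ones. -/
noncomputable def halfLine (a : A) : A ≀ᵣ Multiplicative ℤ :=
  wreathBase (Set.mulIndicator (Set.Ici 1) fun _ => a)

theorem commutator_halfLine_wreathShift (a : A) :
    ⁅halfLine a, wreathShift⁆ = wreathCoord a := by
  rw [commutatorElement_def, mul_assoc, mul_assoc, ← mul_assoc wreathShift, halfLine, wreathShift,
    ← map_inv, inl_mul_wreathBase_mul_inv, ← map_mul]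
  refine congrArg wreathBase (funext fun x => ?_)
  have hx : 1 ≤ (Multiplicative.ofAdd 1)⁻¹ * x ↔ 1 < x := by
    rw [le_inv_mul_iff_mul_le, mul_one]
    exact Int.add_one_le_iff (a := 0)
  change Set.mulIndicator _ _ x * (Set.mulIndicator _ _ _)⁻¹ =
    Pi.mulSingle (M := fun _ => A) 1 a x
  simp only [Set.mulIndicator_apply, Set.mem_Ici, Pi.mulSingle_apply, hx]
  rcases lt_trichotomy x 1 with h | rfl | h
  · simp [h.not_ge, h.not_gt, h.ne]
  · simp
  · simp [h.ne', h, h.le]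

/-- The subgroup of `(A ≀ ℤ) ≀ ℤ` generated by the shift and by the element of the base group
carrying the half-lines of the terms of `a`. -/
def sequenceHull (a : ℕ → A) : Subgroup ((A ≀ᵣ Multiplicative ℤ) ≀ᵣ Multiplicative ℤ) :=
  Subgroup.closure {wreathBase (oddExtension wreathShift fun n => halfLine (a n)), wreathShift}

theorem wreathShift_mem_sequenceHull (a : ℕ → A) : wreathShift ∈ sequenceHull a :=
  Subgroup.subset_closure (Set.mem_insert_of_mem _ (Set.mem_singleton _))

theorem wreathCoord_wreathCoord_mem_sequenceHull (a : ℕ → A) (n : ℕ) :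
    wreathCoord (wreathCoord (a n)) ∈ sequenceHull a := by
  have hf : wreathBase (oddExtension wreathShift fun n => halfLine (a n)) ∈ sequenceHull a :=
    Subgroup.subset_closure (Set.mem_insert _ _)
  have hq : inl (Multiplicative.ofAdd (2 * n + 1 : ℤ)) ∈ sequenceHull a := by
    rw [← wreathShift_zpow]
    exact zpow_mem (wreathShift_mem_sequenceHull a) _
  have hcomm := commutator_conj_wreathBase
    (oddExtension_mul_eq_one_or wreathShift (fun n => halfLine (a n)) n)
  rw [oddExtension_odd, oddExtension_one, commutator_halfLine_wreathShift] at hcomm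
  rw [← hcomm, commutatorElement_def]
  have hconj := mul_mem (mul_mem (inv_mem hq) hf) hq
  exact mul_mem (mul_mem (mul_mem hconj hf) (inv_mem hconj)) (inv_mem hf)

theorem exists_fg_torsionFree_overgroup.{u} {A : Type u} [Group A] [Countable A]
    (hA : TorsionFreeGroup A) :
    ∃ (W : Type u) (_ : Group W) (ε : A →* W), Group.FG W ∧ TorsionFreeGroup W ∧
      Function.Injective ε ∧ IsIsolated ε.range ∧ ε.range ≠ ⊤ := by
  obtain ⟨a, ha⟩ := exists_surjective_nat A
  have hZ : TorsionFreeGroup (Multiplicative ℤ) := torsionFreeGroup_of_isMulTorsionFree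
  have hAZ : TorsionFreeGroup (A ≀ᵣ Multiplicative ℤ) := torsionFreeGroup_wreath hA hZ
  let δ : A →* (A ≀ᵣ Multiplicative ℤ) ≀ᵣ Multiplicative ℤ := wreathCoord.comp wreathCoord
  have hδ : Function.Injective δ := wreathCoord_injective.comp wreathCoord_injective
  have hδr : IsIsolated δ.range := by
    rw [MonoidHom.range_comp]
    exact (isIsolated_range_wreathCoord hA hZ).map wreathCoord_injective
      (isIsolated_range_wreathCoord hAZ hZ)
  have hmem : ∀ x, δ x ∈ sequenceHull a := ha.forall.2 (wreathCoord_wreathCoord_mem_sequenceHull a)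
  refine ⟨sequenceHull a, inferInstance, δ.codRestrict _ hmem,
    (Group.fg_iff_subgroup_fg _).2 ((Subgroup.fg_iff _).2 ⟨_, rfl, Set.toFinite _⟩),
    (torsionFreeGroup_wreath hAZ hZ).of_injective (sequenceHull a).subtype_injective,
    δ.injective_codRestrict _ hmem |>.2 hδ, ?_, fun htop => ?_⟩
  · have hrange : (δ.codRestrict _ hmem).range = δ.range.comap (sequenceHull a).subtype := by
      ext x
      exact exists_congr fun c => Subtype.ext_iff
    exact hrange ▸ hδr.comap _
  · obtain ⟨c, hc⟩ :=
      htop.ge (Subgroup.mem_top ⟨wreathShift, wreathShift_mem_sequenceHull a⟩)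
    have hright : (1 : Multiplicative ℤ) = Multiplicative.ofAdd 1 :=
      congrArg (fun x => right x.1) hc
    exact zero_ne_one (Multiplicative.ofAdd.injective hright)

end Embedding

theorem subgroup_fg_map {G K : Type*} [Group G] [Group K] {H : Subgroup G} (hH : H.FG)
    (f : G →* K) : (H.map f).FG :=
  (Subgroup.fg_iff_submonoid_fg _).2 (((Subgroup.fg_iff_submonoid_fg H).1 hH).map f)

theorem DivisorClosed.one_mem {O : Set ℕ} (hO : DivisorClosed O) (h0 : 0 ∈ O) (hne : O ≠ {0}) :
    1 ∈ O := by
  obtain ⟨n, hn, hn0⟩ := (Set.nontrivial_iff_ne_singleton h0).2 hne |>.exists_ne 0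
  exact hO n hn hn0 1 (one_dvd n)

theorem exists_fg_torsionFree_relSpectrum_eq {O : Set ℕ} (hO : DivisorClosed O) (h0 : 0 ∈ O)
    (hne : O ≠ {0}) :
    ∃ (G : Type) (_ : Group G) (H : Subgroup G),
      Group.FG G ∧ TorsionFreeGroup G ∧ H.FG ∧ relSpectrum (H : Set G) = O := by
  have : Nonempty ↥(O \ {0}) := ⟨1, hO.one_mem h0 hne, one_ne_zero⟩
  obtain ⟨A, _, H, _, hA, hH, hs⟩ := exists_torsionFree_insert_zero_relSpectrum_eq
    fun n : ↥(O \ {0}) => Nat.pos_of_ne_zero n.2.2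
  obtain ⟨W, _, ε, hWfg, hW, hε, hεr, hεne⟩ := exists_fg_torsionFree_overgroup hA
  refine ⟨W, _, H.map ε, hWfg, hW, subgroup_fg_map hH ε, ?_⟩
  rw [relSpectrum_map hε hεr hεne, hs]
  ext d
  constructor
  · rintro (rfl | ⟨n, hd⟩)
    exacts [h0, hO n n.2.1 n.2.2 d hd]
  · intro hd
    by_cases hd0 : d = 0
    exacts [Or.inl hd0, Or.inr ⟨⟨d, hd, hd0⟩, dvd_rfl⟩]

section Computability

open Encodable (encode decode)
open Nat.Partrec (Code)

variable {α β : Type*} [Primcodable α] [Primcodable β]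

theorem rePred_iff_exists_computable {p : α → Prop} :
    REPred p ↔ ∃ q : α → ℕ → Bool, Computable₂ q ∧ ∀ a, p a ↔ ∃ n, q a n = true := by
  constructor
  · intro hp
    obtain ⟨c, hc⟩ := Code.exists_code.1 hp
    refine ⟨fun a n => (Code.evaln n c (encode a)).isSome, Primrec.to_comp ?_, fun a => ?_⟩
    · exact Primrec.option_isSome.comp <| Code.primrec_evaln.comp <|
        (Primrec.snd.pair (.const c)).pair (Primrec.encode.comp .fst)
    · have hdom : (c.eval (encode a)).Dom ↔ p a := by
        simp [hc, Part.assert]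
      simp only [← hdom, Part.dom_iff_mem, Code.evaln_complete, Option.isSome_iff_exists]
      exact exists_comm
  · rintro ⟨q, hq, hpq⟩
    refine (Partrec.rfind hq.partrec₂).dom_re.of_eq fun a => ?_
    simp [Nat.rfind_dom, hpq]

theorem rePred_or {p q : α → Prop} (hp : REPred p) (hq : REPred q) :
    REPred fun a => p a ∨ q a := by
  obtain ⟨s, hs, hps⟩ := rePred_iff_exists_computable.1 hp
  obtain ⟨t, ht, hqt⟩ := rePred_iff_exists_computable.1 hq
  refine rePred_iff_exists_computable.2
    ⟨fun a n => s a n || t a n, Primrec.or.to_comp.comp hs ht, fun a => ?_⟩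
  simp only [hps, hqt, Bool.or_eq_true, exists_or]

theorem rePred_and {p q : α → Prop} (hp : REPred p) (hq : REPred q) :
    REPred fun a => p a ∧ q a := by
  obtain ⟨s, hs, hps⟩ := rePred_iff_exists_computable.1 hp
  obtain ⟨t, ht, hqt⟩ := rePred_iff_exists_computable.1 hq
  have hunpair : Computable fun x : α × ℕ => x.2.unpair := Computable.unpair.comp .snd
  refine rePred_iff_exists_computable.2
    ⟨fun a n => s a n.unpair.1 && t a n.unpair.2, Primrec.and.to_comp.comp
      (hs.comp .fst (Computable.fst.comp hunpair))
      (ht.comp .fst (Computable.snd.comp hunpair)), fun a => ?_⟩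
  simp only [hps, hqt, Bool.and_eq_true]
  exact ⟨fun ⟨⟨m, hm⟩, ⟨n, hn⟩⟩ => ⟨Nat.pair m n, by simpa using ⟨hm, hn⟩⟩,
    fun ⟨n, hm, hn⟩ => ⟨⟨_, hm⟩, ⟨_, hn⟩⟩⟩

theorem rePred_exists {p : α → β → Prop} (hp : REPred fun x : α × β => p x.1 x.2) :
    REPred fun a => ∃ b, p a b := by
  obtain ⟨s, hs, hps⟩ := rePred_iff_exists_computable.1 hp
  have hunpair : Computable fun x : α × ℕ => x.2.unpair := Computable.unpair.comp .snd
  refine rePred_iff_exists_computable.2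
    ⟨fun a n => (decode (α := β) n.unpair.1).casesOn false fun b => s (a, b) n.unpair.2,
      Computable.option_casesOn (Computable.decode.comp (Computable.fst.comp hunpair))
        (.const false) ?_, fun a => ?_⟩
  · exact hs.comp ((Computable.fst.comp .fst).pair .snd)
      (Computable.snd.comp (hunpair.comp .fst))
  · constructor
    · rintro ⟨b, hb⟩
      obtain ⟨n, hn⟩ := (hps (a, b)).1 hb
      exact ⟨Nat.pair (encode b) n, by simpa using hn⟩
    · rintro ⟨n, hn⟩
      cases hb : decode (α := β) n.unpair.1 with
      | none => simp [hb] at hn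
      | some b => exact ⟨b, (hps (a, b)).2 ⟨n.unpair.2, by simpa [hb] using hn⟩⟩

theorem rePred_of_manyOneReducible {p : α → Prop} {q : β → Prop} (hpq : p ≤₀ q)
    (hq : REPred q) : REPred p := by
  obtain ⟨f, hf, hfq⟩ := hpq
  have hqf : REPred fun a => q (f a) := Partrec.comp hq hf
  exact hqf.of_eq fun a => (hfq a).symm

theorem primrecRel_dvd : PrimrecRel ((· ∣ ·) : ℕ → ℕ → Prop) :=
  (Primrec.eq.comp (Primrec.nat_mod.comp .snd .fst) (.const 0)).of_eq fun _ =>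
    Nat.dvd_iff_mod_eq_zero.symm

end Computability

section DivisorCode

variable {α : Type*}

/-- The divisors of the values of `f` on `S`, together with `0` and `1`. When the values of `f` are
pairwise coprime, the set `S` can be recovered from this divisor-closed set. -/
def divisorCode (f : α → ℕ) (S : Set α) : Set ℕ :=
  {d | d ≤ 1 ∨ ∃ a ∈ S, d ∣ f a}

theorem divisorClosed_divisorCode (f : α → ℕ) (S : Set α) : DivisorClosed (divisorCode f S) := by
  rintro n (hn | ⟨a, ha, hna⟩) hn0 d hd
  · exact Or.inl ((Nat.le_of_dvd (Nat.pos_of_ne_zero hn0) hd).trans hn)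
  · exact Or.inr ⟨a, ha, hd.trans hna⟩

theorem exists_fg_torsionFree_relSpectrum_eq_divisorCode (f : α → ℕ) (S : Set α) :
    ∃ (G : Type) (_ : Group G) (H : Subgroup G), Group.FG G ∧ TorsionFreeGroup G ∧ H.FG ∧
      relSpectrum (H : Set G) = divisorCode f S :=
  exists_fg_torsionFree_relSpectrum_eq (divisorClosed_divisorCode f S) (Or.inl zero_le_one)
    fun h => one_ne_zero (h.le (Or.inl le_rfl))

theorem mem_divisorCode_iff {f : α → ℕ} (h1 : ∀ a, 1 < f a)
    (hf : Pairwise (Function.onFun Nat.Coprime f)) {S : Set α} {a : α} :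
    f a ∈ divisorCode f S ↔ a ∈ S := by
  constructor
  · rintro (h | ⟨b, hb, hab⟩)
    · exact absurd h (h1 a).not_ge
    · by_contra ha
      have hcoprime : Nat.Coprime (f a) (f b) := hf (ne_of_mem_of_not_mem hb ha).symm
      exact (h1 a).ne' (hcoprime.eq_one_of_dvd hab)
  · exact fun ha => Or.inr ⟨a, ha, dvd_rfl⟩

variable [Primcodable α]

theorem manyOneReducible_divisorCode {f : α → ℕ} (hfc : Computable f) (h1 : ∀ a, 1 < f a)
    (hf : Pairwise (Function.onFun Nat.Coprime f)) (S : Set α) :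
    (· ∈ S) ≤₀ (· ∈ divisorCode f S) :=
  ⟨f, hfc, fun _ => (mem_divisorCode_iff h1 hf).symm⟩

theorem rePred_mem_divisorCode {f : α → ℕ} (hfc : Computable f) {S : Set α}
    (hS : REPred (· ∈ S)) : REPred (· ∈ divisorCode f S) := by
  have hle : ComputablePred fun d : ℕ => d ≤ 1 :=
    (Primrec.nat_le.comp .id (.const 1)).computablePred
  have hmem : REPred fun x : ℕ × α => x.2 ∈ S :=
    rePred_of_manyOneReducible ⟨Prod.snd, .snd, fun _ => Iff.rfl⟩ hS
  have hdvd : REPred fun x : ℕ × α => x.1 ∣ f x.2 :=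
    rePred_of_manyOneReducible ⟨Prod.map id f, Computable.fst.pair (hfc.comp .snd),
      fun _ => Iff.rfl⟩ primrecRel_dvd.computablePred.to_re
  exact rePred_or hle.to_re (rePred_exists (rePred_and hmem hdvd))

end DivisorCode

section FermatCode

open Encodable (encode)

variable {α : Type*}

/-- Pairwise coprime numbers greater than `1` indexed by the elements of an encodable type. -/
def fermatCode [Encodable α] (a : α) : ℕ := Nat.fermatNumber (encode a)

theorem one_lt_fermatCode [Encodable α] (a : α) : 1 < fermatCode a :=
  one_lt_two.trans (Nat.two_lt_fermatNumber _)

theorem pairwise_coprime_fermatCode [Encodable α] :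
    Pairwise (Function.onFun Nat.Coprime (fermatCode : α → ℕ)) := fun _ _ h =>
  Nat.coprime_fermatNumber_fermatNumber (Encodable.encode_injective.ne h)

theorem primrec_fermatNumber : Primrec Nat.fermatNumber := by
  have h : Primrec fun n : ℕ => Nat.rec (motive := fun _ => ℕ) 2 (fun _ y => y * y) n :=
    Primrec.nat_rec₁ 2 ((Primrec.nat_mul.comp Primrec.snd Primrec.snd).to₂)
  refine (Primrec.succ.comp h).of_eq fun n => ?_
  rw [Nat.fermatNumber, Nat.succ_eq_add_one]
  congr 1
  induction n with
  | zero => rfl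
  | succ n ih => rw [pow_succ, pow_mul, ← ih, sq]

theorem computable_fermatCode [Primcodable α] : Computable (fermatCode : α → ℕ) :=
  (primrec_fermatNumber.comp Primrec.encode).to_comp

theorem manyOneReducible_divisorCode_fermatCode [Primcodable α] (S : Set α) :
    (· ∈ S) ≤₀ (· ∈ divisorCode fermatCode S) :=
  manyOneReducible_divisorCode computable_fermatCode one_lt_fermatCode
    pairwise_coprime_fermatCode S

end FermatCode

theorem mainTheorem1 :
    (∀ O : Set ℕ, DivisorClosed O → 0 ∈ O → O ≠ {0} →
      ∃ (G : Type) (_ : Group G) (H : Subgroup G),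
        Group.FG G ∧ TorsionFreeGroup G ∧ H.FG ∧ relSpectrum (H : Set G) = O) ∧
    (∃ (G : Type) (_ : Group G) (H : Subgroup G),
        Group.FG G ∧ TorsionFreeGroup G ∧ H.FG ∧
        ¬ REPred (fun n : ℕ => n ∈ relSpectrum (H : Set G))) ∧
    (∃ (G : Type) (_ : Group G) (H : Subgroup G),
        Group.FG G ∧ TorsionFreeGroup G ∧ H.FG ∧
        REPred (fun n : ℕ => n ∈ relSpectrum (H : Set G)) ∧
        ¬ ComputablePred (fun n : ℕ => n ∈ relSpectrum (H : Set G))) := by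
  refine ⟨fun _ hO h0 hne => exists_fg_torsionFree_relSpectrum_eq hO h0 hne, ?_, ?_⟩
  · obtain ⟨G, hG, H, hGfg, hGtf, hH, hs⟩ := exists_fg_torsionFree_relSpectrum_eq_divisorCode
      fermatCode {c : Nat.Partrec.Code | ¬ (c.eval 0).Dom}
    refine ⟨G, hG, H, hGfg, hGtf, hH, fun hre => ComputablePred.halting_problem_not_re 0 ?_⟩
    exact rePred_of_manyOneReducible (manyOneReducible_divisorCode_fermatCode _) (hs ▸ hre)
  · obtain ⟨G, hG, H, hGfg, hGtf, hH, hs⟩ := exists_fg_torsionFree_relSpectrum_eq_divisorCode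
      fermatCode {c : Nat.Partrec.Code | (c.eval 0).Dom}
    refine ⟨G, hG, H, hGfg, hGtf, hH, ?_, fun hc => ComputablePred.halting_problem 0 ?_⟩
    · rw [hs]
      exact rePred_mem_divisorCode computable_fermatCode (ComputablePred.halting_problem_re 0)
    · exact ComputablePred.computable_of_manyOneReducible
        (manyOneReducible_divisorCode_fermatCode _) (hs ▸ hc)
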